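/- Let $n\ge 2$. A function $q:(0,\infty)\to\mathbb{C}$ is said to be in the class $\mathcal{A}$ with exponent $\rho>\frac32$ if it extends to a function on the closed half-plane $\{\operatorname{Re} z\ge 0\}$ which is holomorphic in $\{\operatorname{Re} z>0\}$, continuous up to the boundary, and satisfies $|q(z)|\le C(1+|z|)^{-\rho}$ for $\operatorname{Re} z\ge 0$ with some constant $C$. A central potential in the class $\mathcal{A}$ is a function $V$ on $\mathbb{R}^n$ with $V(x)=q(|x|)$ for $x\ne 0$, where $q$ is in $\mathcal{A}$. Write $$\hat V(\xi)=(2\pi)^{-n/2}\int_{\mathbb{R}^n}e^{-ix\cdot\xi}\,V(x)\,dx .$$ Let $V_1,V_2$ be central potentials on $\mathbb{R}^n$ in the class $\mathcal{A}$ with exponents $\rho_1>n$ and $\rho_2>n$ respectively. If there is a ball $B(c,R)\subset\mathbb{R}^n$, with arbitrary centre $c\in\mathbb{R}^n$ and radius $R>0$, such that $\hat V_1(\xi)=\hat V_2(\xi)$ for all $\xi\in B(c,R)$, then $V_1(x)=V_2(x)$ for all $x\in\mathbb{R}^n\setminus\{0\}$. In other words, the restriction of the Fourier transform to any ball determines a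 central potential in $\mathcal{A}$ with $\rho>n$ uniquely among such potentials. -/

import Mathlib

open MeasureTheory

/-- `InClassA ρ q`: the radial profile `q`, a function on `(0, ∞)` (values at `r ≤ 0` are ignored),
belongs to the class `𝒜` with decay exponent `ρ > 3/2`: it extends to a function `Q` on the closed
half-plane `Re z ≥ 0`, holomorphic in the interior and continuous up to the boundary, such that
`|Q z| ≤ C (1 + |z|) ^ (-ρ)` on the closed half-plane. -/
def InClassA (ρ : ℝ) (q : ℝ → ℂ) : Prop :=
  3 / 2 < ρ ∧ ∃ Q : ℂ → ℂ,
    DifferentiableOn ℂ Q {z | 0 < z.re} ∧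
    ContinuousOn Q {z | 0 ≤ z.re} ∧
    (∀ r : ℝ, 0 < r → Q (r : ℂ) = q r) ∧
    ∃ C : ℝ, ∀ z : ℂ, 0 ≤ z.re → ‖Q z‖ ≤ C * (1 + ‖z‖) ^ (-ρ)

/-- `V` is a central (spherically symmetric) potential on `ℝⁿ`, `V x = q |x|` for `x ≠ 0`, whose
radial profile `q` is in the class `𝒜` with decay exponent `ρ`. -/
def IsCentralInClassA {n : ℕ} (ρ : ℝ) (V : EuclideanSpace ℝ (Fin n) → ℂ) : Prop :=
  ∃ q : ℝ → ℂ, InClassA ρ q ∧ ∀ x, x ≠ 0 → V x = q ‖x‖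

/-- The Fourier transform `(2π)^(-n/2) ∫ e^{-i x·ξ} V x dx` on `ℝⁿ`. -/
noncomputable def fourierHat {n : ℕ} (V : EuclideanSpace ℝ (Fin n) → ℂ)
    (ξ : EuclideanSpace ℝ (Fin n)) : ℂ :=
  (((2 * Real.pi) ^ (-(n : ℝ) / 2) : ℝ) : ℂ) *
    ∫ x : EuclideanSpace ℝ (Fin n),
      Complex.exp (-Complex.I * ((inner ℝ x ξ : ℝ) : ℂ)) * V x

open Set Filter Topology Complex
open scoped Interval

/-! Let `Q` be the difference of the two extended profiles; its transform vanishes on a ball. In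
polar coordinates the transform at `k • e` is, on each ray `ω`, the integral of `exp (-i k s r) Q(r)
r^n` against `dr/r`, with `s = ω·e`. Analyticity and decay of `Q` allow turning the contour onto the
imaginary half-axis where the exponential decays. The outcome,
`integral_cexp_mul_radial_eq_integral_rotatedProfile`, is an integral of `exp (-k |x·e|)` against an
integrable function independent of `k`, hence holomorphic for `Re k > 0`.

By the identity theorem, vanishing on an interval of one ray spreads to the whole ray, by radial
symmetry to every nonzero frequency, and Fourier inversion then gives `Q = 0` on the half-line. -/

/-! ### Contour rotation -/

/-- Shifting a line integral across a horizontal strip. -/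
theorem integral_ofReal_eq_integral_add_mul_I {g : ℂ → ℂ} {α : ℝ} {b : ℝ → ℝ}
    (hgc : ContinuousOn g {u | u.im ∈ [[0, α]]})
    (hgd : DifferentiableOn ℂ g {u | u.im ∈ Ioo (min 0 α) (max 0 α)})
    (hgb : ∀ u : ℂ, u.im ∈ [[0, α]] → ‖g u‖ ≤ b u.re)
    (hb : Integrable b) (hb_top : Tendsto b atTop (𝓝 0)) (hb_bot : Tendsto b atBot (𝓝 0)) :
    ∫ x : ℝ, g x = ∫ x : ℝ, g (x + α * I) := by
  have hcauchy : ∀ T : ℝ, (∫ x in (-T)..T, g x) - (∫ x in (-T)..T, g (x + α * I)) +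
      I • (∫ y in (0 : ℝ)..α, g (T + y * I)) - I • (∫ y in (0 : ℝ)..α, g ((-T : ℝ) + y * I))
      = 0 := by
    intro T
    have h := integral_boundary_rect_eq_zero_of_continuousOn_of_differentiableOn g
      ((-T : ℝ) : ℂ) (T + α * I)
      (hgc.mono fun u hu => by simpa using hu.2) (hgd.mono fun u hu => by simpa using hu.2)
    simpa using h
  have hint : ∀ β ∈ [[0, α]], Integrable fun x : ℝ => g (x + β * I) := by
    intro β hβ
    refine hb.mono' (Continuous.aestronglyMeasurable ?_) (ae_of_all _ fun x => ?_)
    · exact hgc.comp_continuous (by fun_prop) fun x => by simpa using hβ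
    · simpa using hgb (x + β * I) (by simpa using hβ)
  have hside : ∀ {l : Filter ℝ} {φ : ℝ → ℝ}, Tendsto (fun T => b (φ T)) l (𝓝 0) →
      Tendsto (fun T : ℝ => I • ∫ y in (0 : ℝ)..α, g ((φ T : ℝ) + y * I)) l (𝓝 0) := by
    intro l φ h
    suffices h' : Tendsto (fun T : ℝ => ∫ y in (0 : ℝ)..α, g ((φ T : ℝ) + y * I)) l (𝓝 0) by
      simpa using h'.const_smul I
    refine squeeze_zero_norm (a := fun T => b (φ T) * |α - 0|) (fun T => ?_)
      (by simpa using h.mul_const |α - 0|)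
    refine intervalIntegral.norm_integral_le_of_norm_le_const fun y hy => ?_
    simpa using hgb ((φ T : ℝ) + y * I) (by simpa using uIoc_subset_uIcc hy)
  have h0 : Integrable fun x : ℝ => g x := by simpa using hint 0 left_mem_uIcc
  have hα := hint α right_mem_uIcc
  have hl := (((intervalIntegral_tendsto_integral h0 tendsto_neg_atTop_atBot tendsto_id).sub
    (intervalIntegral_tendsto_integral hα tendsto_neg_atTop_atBot tendsto_id)).add
    (hside (φ := fun T => T) hb_top)).sub
    (hside (φ := fun T => -T) (hb_bot.comp tendsto_neg_atTop_atBot))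
  have := tendsto_nhds_unique (hl.congr hcauchy) tendsto_const_nhds
  simpa [sub_eq_zero] using this

/-- The logarithmic coordinate turns `dr/r` into Lebesgue measure, and so a rotation of rays into a
shift of horizontal lines. -/
theorem integral_comp_exp_eq_integral_Ioi_inv_smul (g : ℝ → ℂ) :
    ∫ x : ℝ, g (Real.exp x) = ∫ r in Ioi (0 : ℝ), r⁻¹ • g r := by
  have h := integral_image_eq_integral_abs_deriv_smul (s := univ) MeasurableSet.univ
    (fun x _ => (Real.hasDerivAt_exp x).hasDerivWithinAt) Real.exp_injective.injOn
    (fun r => r⁻¹ • g r)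
  rw [image_univ, Real.range_exp] at h
  rw [h, setIntegral_univ]
  refine integral_congr_ae (ae_of_all _ fun x => ?_)
  simp only [abs_of_pos (Real.exp_pos x), smul_smul]
  rw [mul_inv_cancel₀ (Real.exp_pos x).ne', one_smul]

theorem integrable_comp_exp_iff_integrableOn_Ioi (g : ℝ → ℝ) :
    Integrable (fun x : ℝ => g (Real.exp x)) ↔ IntegrableOn (fun r => r⁻¹ * g r) (Ioi 0) := by
  have h := integrableOn_image_iff_integrableOn_abs_deriv_smul (s := univ) MeasurableSet.univ
    (fun x _ => (Real.hasDerivAt_exp x).hasDerivWithinAt) Real.exp_injective.injOn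
    (fun r => r⁻¹ * g r)
  rw [image_univ, Real.range_exp, integrableOn_univ] at h
  rw [h]
  refine integrable_congr (ae_of_all _ fun x => ?_)
  simp only [abs_of_pos (Real.exp_pos x), smul_eq_mul]
  rw [mul_inv_cancel_left₀ (Real.exp_pos x).ne']

/-- Rotating the contour of a radial integral from the positive real half-axis to the negative
(`σ = 1`) or positive (`σ = -1`) imaginary half-axis. -/
theorem integral_Ioi_eq_integral_imaginary_axis {F : ℂ → ℂ} {σ : ℝ} (hσ : σ = 1 ∨ σ = -1)
    {B : ℝ → ℝ} (hFc : ContinuousOn F {z | 0 ≤ z.re}) (hFd : DifferentiableOn ℂ F {z | 0 < z.re})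
    (hFb : ∀ z : ℂ, 0 ≤ z.re → σ * z.im ≤ 0 → ‖F z‖ ≤ B ‖z‖)
    (hB : IntegrableOn (fun r => r⁻¹ * B r) (Ioi 0)) (hB_top : Tendsto B atTop (𝓝 0))
    (hB_zero : Tendsto B (𝓝[>] 0) (𝓝 0)) :
    ∫ r in Ioi (0 : ℝ), r⁻¹ • F r = ∫ r in Ioi (0 : ℝ), r⁻¹ • F (-σ * I * r) := by
  -- `exp` maps the closed strip into the quadrant where the bound on `F` is assumed.
  have hmem : ∀ y ∈ [[0, -σ * (Real.pi / 2)]], 0 ≤ Real.cos y ∧ σ * Real.sin y ≤ 0 := by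
    intro y hy
    have hpi := Real.pi_pos
    rcases hσ with rfl | rfl
    · rw [uIcc_of_ge (by linarith)] at hy
      exact ⟨Real.cos_nonneg_of_mem_Icc ⟨by linarith [hy.1], by linarith [hy.2]⟩, by
        simpa using Real.sin_nonpos_of_nonpos_of_neg_pi_le hy.2 (by linarith [hy.1])⟩
    · rw [uIcc_of_le (by linarith)] at hy
      exact ⟨Real.cos_nonneg_of_mem_Icc ⟨by linarith [hy.1], by linarith [hy.2]⟩, by
        simpa using Real.sin_nonneg_of_nonneg_of_le_pi hy.1 (by linarith [hy.2])⟩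
  have hmem' : ∀ y ∈ Ioo (min 0 (-σ * (Real.pi / 2))) (max 0 (-σ * (Real.pi / 2))),
      0 < Real.cos y := by
    intro y hy
    have hpi := Real.pi_pos
    rcases hσ with rfl | rfl
    · rw [min_eq_right (by linarith), max_eq_left (by linarith)] at hy
      exact Real.cos_pos_of_mem_Ioo ⟨by linarith [hy.1], by linarith [hy.2]⟩
    · rw [min_eq_left (by linarith), max_eq_right (by linarith)] at hy
      exact Real.cos_pos_of_mem_Ioo ⟨by linarith [hy.1], by linarith [hy.2]⟩
  have h := integral_ofReal_eq_integral_add_mul_I (g := fun u => F (exp u))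
    (α := -σ * (Real.pi / 2)) (b := fun x => B (Real.exp x))
    (hFc.comp (by fun_prop) fun u hu => by
      simpa [exp_re] using mul_nonneg (Real.exp_pos _).le (hmem _ hu).1)
    (hFd.comp (by fun_prop) fun u hu => by
      simpa [exp_re] using mul_pos (Real.exp_pos _) (hmem' _ hu))
    (fun u hu => by
      have h1 := hmem _ hu
      have := hFb (exp u) (by simpa [exp_re] using mul_nonneg (Real.exp_pos _).le h1.1) (by
        rw [exp_im, mul_left_comm]
        exact mul_nonpos_of_nonneg_of_nonpos (Real.exp_pos _).le h1.2)
      rwa [norm_exp] at this)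
    ((integrable_comp_exp_iff_integrableOn_Ioi B).2 hB)
    (hB_top.comp Real.tendsto_exp_atTop) (hB_zero.comp Real.tendsto_exp_atBot_nhdsGT)
  have hrot : exp (((-σ * (Real.pi / 2) : ℝ) : ℂ) * I) = -σ * I := by
    rcases hσ with rfl | rfl
    · rw [exp_mul_I, ← ofReal_cos, ← ofReal_sin]; simp
    · rw [exp_mul_I, ← ofReal_cos, ← ofReal_sin]; simp
  rw [← integral_comp_exp_eq_integral_Ioi_inv_smul fun r => F r,
    ← integral_comp_exp_eq_integral_Ioi_inv_smul fun r => F (-σ * I * r)]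
  simp only [exp_add, hrot] at h
  simp only [ofReal_exp]
  rw [h]
  refine integral_congr_ae (ae_of_all _ fun x => ?_)
  simp only [mul_comm]

/-! ### Polar coordinates -/

section Polar

variable {E : Type*} [NormedAddCommGroup E] [NormedSpace ℝ E] [MeasurableSpace E]
  [FiniteDimensional ℝ E] [BorelSpace E] [Nontrivial E]

/-- Integration in polar coordinates. -/
theorem integral_eq_integral_toSphere_integral_Ioi (μ : Measure E) [μ.IsAddHaarMeasure]
    {f : E → ℂ} (hf : Integrable f μ) :
    ∫ x, f x ∂μ = ∫ ω : Metric.sphere (0 : E) 1,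
      (∫ r in Ioi (0 : ℝ), r ^ (Module.finrank ℝ E - 1) • f (r • (ω : E))) ∂μ.toSphere := by
  have hmp := μ.measurePreserving_homeomorphUnitSphereProd
  have hemb := (homeomorphUnitSphereProd E).measurableEmbedding
  set g : Metric.sphere (0 : E) 1 × Ioi (0 : ℝ) → ℂ := fun p => f (p.2.1 • p.1.1) with hg
  have hcomp : ∀ x : ({0}ᶜ : Set E), g (homeomorphUnitSphereProd E x) = f x := by
    intro x
    have hx : ‖(x : E)‖ ≠ 0 := norm_ne_zero_iff.2 x.2
    simp [hg, smul_smul, mul_inv_cancel₀ hx]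
  have hgint : Integrable g (μ.toSphere.prod (.volumeIoiPow (Module.finrank ℝ E - 1))) := by
    rw [← hmp.integrable_comp_emb hemb]
    have : g ∘ homeomorphUnitSphereProd E = fun x : ({0}ᶜ : Set E) => f x := funext hcomp
    rw [this]
    exact (integrableOn_iff_comap_subtypeVal (measurableSet_singleton _).compl).1 hf.integrableOn
  calc
    ∫ x, f x ∂μ = ∫ x : ({0}ᶜ : Set E), f x ∂(μ.comap (↑)) := by
      rw [integral_subtype_comap (measurableSet_singleton _).compl f, restrict_compl_singleton]
    _ = ∫ p, g p ∂μ.toSphere.prod (.volumeIoiPow (Module.finrank ℝ E - 1)) := by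
      rw [← hmp.integral_comp hemb]
      exact integral_congr_ae (ae_of_all _ fun x => (hcomp x).symm)
    _ = _ := by
      rw [integral_prod g hgint]
      refine integral_congr_ae (ae_of_all _ fun ω => ?_)
      simp only [Measure.volumeIoiPow, ENNReal.ofReal, hg]
      rw [integral_withDensity_eq_integral_smul,
        integral_subtype_comap measurableSet_Ioi fun a =>
          Real.toNNReal (a ^ (Module.finrank ℝ E - 1)) • f (a • (ω : E)),
        setIntegral_congr_fun measurableSet_Ioi fun x hx => ?_]
      · rw [NNReal.smul_def, Real.coe_toNNReal _ (pow_nonneg hx.out.le _)]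
      · exact (measurable_subtype_coe.pow_const _).real_toNNReal

end Polar

/-! ### Holomorphy in the parameter, and limits of the majorant -/

theorem differentiableOn_integral_cexp_neg_mul {X : Type*} [MeasurableSpace X] {μ : Measure X}
    {a : X → ℝ} (ha : Measurable a) (ha0 : ∀ x, 0 ≤ a x) {G : X → ℂ} (hG : Integrable G μ) :
    DifferentiableOn ℂ (fun k : ℂ => ∫ x, cexp (-k * a x) * G x ∂μ) {k | 0 < k.re} := by
  intro k hk
  have hk' : 0 < k.re := hk
  have hmeas : ∀ k : ℂ, AEStronglyMeasurable (fun x => cexp (-k * a x)) μ := fun k =>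
    Measurable.aestronglyMeasurable (by fun_prop)
  have hs : {z : ℂ | k.re / 2 < z.re} ∈ 𝓝 k :=
    (isOpen_lt continuous_const continuous_re).mem_nhds (by simpa using hk')
  refine (hasDerivAt_integral_of_dominated_loc_of_deriv_le (μ := μ)
    (F := fun k x => cexp (-k * a x) * G x)
    (F' := fun k x => -a x * cexp (-k * a x) * G x)
    -- From `a * exp (-a t) ≤ 1 / t` with `t > k.re / 2`: the exponential absorbs the factor `a`, so
    -- no moment of `G` is needed.
    (bound := fun x => (k.re / 2)⁻¹ * ‖G x‖) hs
    (Eventually.of_forall fun z => (hmeas z).mul hG.1) ?_ ?_ ?_ (hG.norm.const_mul _)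
    ?_).2.differentiableAt.differentiableWithinAt
  · refine hG.norm.mono ((hmeas k).mul hG.1) (ae_of_all _ fun x => ?_)
    rw [norm_mul, norm_norm, norm_exp]
    refine mul_le_of_le_one_left (norm_nonneg _) (Real.exp_le_one_iff.2 ?_)
    simpa using mul_nonneg hk'.le (ha0 x)
  · exact ((Measurable.aestronglyMeasurable (by fun_prop)).mul (hmeas k)).mul hG.1
  · refine ae_of_all _ fun x z hz => ?_
    have hz' : k.re / 2 < z.re := hz
    rw [norm_mul, norm_mul, norm_exp, norm_neg, norm_real, Real.norm_of_nonneg (ha0 x)]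
    refine mul_le_mul_of_nonneg_right ?_ (norm_nonneg _)
    have h1 : (-z * a x).re = -(z.re * a x) := by simp
    rw [h1, Real.exp_neg, ← div_eq_mul_inv, div_le_iff₀ (Real.exp_pos _), ← div_eq_inv_mul,
      le_div_iff₀ (by positivity)]
    nlinarith [Real.add_one_le_exp (z.re * a x), mul_le_mul_of_nonneg_right hz'.le (ha0 x)]
  · refine ae_of_all _ fun x z _ => ?_
    have h := (((hasDerivAt_id z).neg.mul_const (a x : ℂ)).cexp).mul_const (G x)
    convert! h using 1
    simp only [Pi.neg_apply, id_eq]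
    ring

theorem tendsto_pow_mul_one_add_rpow_atTop {n : ℕ} {C ρ : ℝ} (hρ : (n : ℝ) < ρ) :
    Tendsto (fun r : ℝ => C * r ^ n * (1 + r) ^ (-ρ)) atTop (𝓝 0) := by
  have h1 : Tendsto (fun r : ℝ => (1 + r) ^ (-(ρ - n))) atTop (𝓝 0) :=
    (tendsto_rpow_neg_atTop (sub_pos.2 hρ)).comp (tendsto_atTop_add_const_left _ _ tendsto_id)
  have h2 : Tendsto (fun r : ℝ => r ^ n * (1 + r) ^ (-ρ)) atTop (𝓝 0) := by
    refine squeeze_zero' ?_ ?_ h1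
    · filter_upwards [eventually_ge_atTop 0] with r hr
      positivity
    · filter_upwards [eventually_ge_atTop 0] with r hr
      have : (1 + r) ^ (-(ρ - n)) = (1 + r) ^ n * (1 + r) ^ (-ρ) := by
        rw [← Real.rpow_natCast, ← Real.rpow_add (by linarith)]
        ring_nf
      rw [this]
      gcongr
      linarith
  simpa [mul_assoc] using h2.const_mul C

theorem tendsto_pow_mul_one_add_rpow_nhdsGT_zero {n : ℕ} (hn : n ≠ 0) (C ρ : ℝ) :
    Tendsto (fun r : ℝ => C * r ^ n * (1 + r) ^ (-ρ)) (𝓝[>] 0) (𝓝 0) := by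
  have h : ContinuousAt (fun r : ℝ => C * r ^ n * (1 + r) ^ (-ρ)) 0 := by
    refine ContinuousAt.mul (by fun_prop) ?_
    exact ContinuousAt.rpow_const (by fun_prop) (by simp)
  have h' := h.tendsto
  simp only [zero_pow hn, mul_zero, zero_mul] at h'
  exact h'.mono_left nhdsWithin_le_nhds

/-! ### Fourier transforms of radial functions -/

section Radial

variable {E : Type*} [NormedAddCommGroup E] [InnerProductSpace ℝ E] [MeasurableSpace E]
  [FiniteDimensional ℝ E] [BorelSpace E]

theorem integrable_of_norm_le_one_add_norm_rpow {f : E → ℂ} {C ρ : ℝ}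
    (hρ : (Module.finrank ℝ E : ℝ) < ρ) (hf : AEStronglyMeasurable f)
    (hb : ∀ x, ‖f x‖ ≤ C * (1 + ‖x‖) ^ (-ρ)) : Integrable f :=
  ((integrable_one_add_norm hρ).const_mul C).mono' hf (ae_of_all _ hb)

/-- The continuation of a radial profile to the imaginary axis that results from rotating the
contour on each ray in the direction in which `exp (-i x·e)` decays. -/
noncomputable def rotatedProfile (Q : ℂ → ℂ) (e x : E) : ℂ :=
  if 0 ≤ inner ℝ x e then (-I) ^ Module.finrank ℝ E * Q (-I * ‖x‖)
  else I ^ Module.finrank ℝ E * Q (I * ‖x‖)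

theorem integrable_rotatedProfile {Q : ℂ → ℂ} {C ρ : ℝ}
    (hρ : (Module.finrank ℝ E : ℝ) < ρ) (hQc : ContinuousOn Q {z | 0 ≤ z.re})
    (hQb : ∀ z : ℂ, 0 ≤ z.re → ‖Q z‖ ≤ C * (1 + ‖z‖) ^ (-ρ)) (e : E) :
    Integrable (rotatedProfile Q e) := by
  have hcont : ∀ c : ℂ, c.re = 0 → Continuous fun x : E => Q (c * ‖x‖) := fun c hc =>
    hQc.comp_continuous (by fun_prop) fun x => by simp [hc]
  refine integrable_of_norm_le_one_add_norm_rpow (C := C) hρ ?_ fun x => ?_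
  · refine (Measurable.ite ?_ ?_ ?_).aestronglyMeasurable
    · exact measurableSet_le measurable_const (by fun_prop)
    · exact ((hcont (-I) (by simp)).measurable).const_mul _
    · exact ((hcont I (by simp)).measurable).const_mul _
  · unfold rotatedProfile
    split_ifs
    · simpa using hQb (-I * ‖x‖) (by simp)
    · simpa using hQb (I * ‖x‖) (by simp)

theorem integral_cexp_inner_eq_fourier (f : E → ℂ) (ξ : E) :
    ∫ x : E, cexp (-I * ((inner ℝ x ξ : ℝ) : ℂ)) * f x =
      FourierTransform.fourier f ((2 * Real.pi)⁻¹ • ξ) := by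
  rw [Real.fourier_eq']
  refine integral_congr_ae (ae_of_all _ fun x => ?_)
  have : (-2 * Real.pi * inner ℝ x ((2 * Real.pi)⁻¹ • ξ) : ℝ) = -inner ℝ x ξ := by
    rw [real_inner_smul_right]
    have := Real.pi_ne_zero
    field_simp
  simp only [smul_eq_mul, this, ofReal_neg]
  ring_nf

/-- The reflection exchanging `ξ` and `η` is an isometry, so it fixes the radial function and
commutes with the transform. -/
theorem fourier_radial_eq_of_norm_eq (q : ℝ → ℂ) {ξ η : E} (h : ‖ξ‖ = ‖η‖) :
    FourierTransform.fourier (fun x : E => q ‖x‖) ξ =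
      FourierTransform.fourier (fun x : E => q ‖x‖) η := by
  have h1 := Real.fourier_comp_linearIsometry
    (Submodule.reflection (Submodule.span ℝ {ξ - η})ᗮ) (fun x : E => q ‖x‖) ξ
  rw [Submodule.reflection_sub h] at h1
  rw [← h1]
  refine congrArg (fun f : E → ℂ => (FourierTransform.fourier f : E → ℂ) ξ) (funext fun x => ?_)
  simp

variable [Nontrivial E]

variable (E) in
-- This is integrability of `(1 + ‖x‖) ^ (-ρ)` on `E`, read in polar coordinates.
theorem integrableOn_Ioi_inv_mul_pow_mul_one_add_rpow {C ρ : ℝ}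
    (hρ : (Module.finrank ℝ E : ℝ) < ρ) :
    IntegrableOn (fun r : ℝ => r⁻¹ * (C * r ^ Module.finrank ℝ E * (1 + r) ^ (-ρ))) (Ioi 0) := by
  have h := (integrable_fun_norm_addHaar (volume : Measure E)
    (f := fun r : ℝ => C * (1 + r) ^ (-ρ))).1 ((integrable_one_add_norm hρ).const_mul C)
  refine h.congr_fun (fun r hr => ?_) measurableSet_Ioi
  have hr' : (r : ℝ) ≠ 0 := ne_of_gt hr
  obtain ⟨m, hm⟩ : ∃ m, Module.finrank ℝ E = m + 1 :=
    Nat.exists_eq_succ_of_ne_zero Module.finrank_pos.ne'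
  simp only [hm, smul_eq_mul, Nat.add_sub_cancel, pow_succ]
  field_simp

theorem integral_cexp_mul_radial_eq_integral_rotatedProfile {Q : ℂ → ℂ} {C ρ : ℝ}
    (hρ : (Module.finrank ℝ E : ℝ) < ρ) (hQd : DifferentiableOn ℂ Q {z | 0 < z.re})
    (hQc : ContinuousOn Q {z | 0 ≤ z.re})
    (hQb : ∀ z : ℂ, 0 ≤ z.re → ‖Q z‖ ≤ C * (1 + ‖z‖) ^ (-ρ)) (e : E) {k : ℝ} (hk : 0 < k) :
    ∫ x : E, cexp (-I * ((inner ℝ x (k • e) : ℝ) : ℂ)) * Q ‖x‖ =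
      ∫ x : E, cexp (-k * (|inner ℝ x e| : ℝ)) * rotatedProfile Q e x := by
  set n := Module.finrank ℝ E with hn
  have hn0 : n ≠ 0 := Module.finrank_pos.ne'
  have hC : 0 ≤ C := by simpa using (norm_nonneg _).trans (hQb 0 le_rfl)
  have hQcont : Continuous fun x : E => Q ‖x‖ :=
    hQc.comp_continuous (by fun_prop) fun x => by simp
  have hint1 : Integrable fun x : E => cexp (-I * ((inner ℝ x (k • e) : ℝ) : ℂ)) * Q ‖x‖ := by
    refine integrable_of_norm_le_one_add_norm_rpow (C := C) hρ
      ((Continuous.mul (by fun_prop) hQcont).aestronglyMeasurable) fun x => ?_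
    have := hQb ‖x‖ (by simp)
    simpa [norm_exp] using this
  have hint2 : Integrable fun x : E => cexp (-k * (|inner ℝ x e| : ℝ)) * rotatedProfile Q e x := by
    have hG := integrable_rotatedProfile hρ hQc hQb e
    refine hG.norm.mono ((Continuous.aestronglyMeasurable (by fun_prop)).mul hG.1)
      (ae_of_all _ fun x => ?_)
    rw [norm_mul, norm_norm, norm_exp]
    refine mul_le_of_le_one_left (norm_nonneg _) (Real.exp_le_one_iff.2 ?_)
    rw [← ofReal_neg, ← ofReal_mul, ofReal_re]
    have := mul_nonneg hk.le (abs_nonneg (inner ℝ x e))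
    linarith
  rw [integral_eq_integral_toSphere_integral_Ioi _ hint1,
    integral_eq_integral_toSphere_integral_Ioi _ hint2]
  refine integral_congr_ae (ae_of_all _ fun ω => ?_)
  set s : ℝ := inner ℝ (ω : E) e with hs
  -- The sign `σ` selects the direction of rotation; `s = 0` goes with `σ = 1`, matching the `≤` in
  -- `rotatedProfile`.
  obtain ⟨σ, hσ, hσs, hσx⟩ : ∃ σ : ℝ, (σ = 1 ∨ σ = -1) ∧ σ * s = |s| ∧ ∀ r : ℝ, 0 < r →
      rotatedProfile Q e (r • (ω : E)) = (-σ * I) ^ n * Q (-σ * I * r) := by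
    have hω : ‖(ω : E)‖ = 1 := by simp
    rcases le_or_gt 0 s with h | h
    · refine ⟨1, Or.inl rfl, by simp [abs_of_nonneg h], fun r hr => ?_⟩
      have h1 : 0 ≤ inner ℝ (r • (ω : E)) e := by
        rw [real_inner_smul_left]; exact mul_nonneg hr.le h
      simp [rotatedProfile, if_pos h1, norm_smul, hω, abs_of_pos hr, hn]
    · refine ⟨-1, Or.inr rfl, by simp [abs_of_neg h], fun r hr => ?_⟩
      have h1 : ¬ 0 ≤ inner ℝ (r • (ω : E)) e := by
        rw [real_inner_smul_left, not_le]; exact mul_neg_of_pos_of_neg hr h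
      simp [rotatedProfile, if_neg h1, norm_smul, hω, abs_of_pos hr, hn]
  have hσσ : σ * σ = 1 := by rcases hσ with rfl | rfl <;> norm_num
  have key := integral_Ioi_eq_integral_imaginary_axis
    -- The exponent is `n`, not `n - 1`, because the measure is `dr/r`; rotating `z ^ n` produces
    -- the factor `(-σ * I) ^ n`.
    (F := fun z => cexp (-I * (k * s) * z) * Q z * z ^ n) hσ
    (B := fun r => C * r ^ n * (1 + r) ^ (-ρ))
    (by fun_prop) (by fun_prop)
    (fun z hz hz' => by
      rw [norm_mul, norm_mul, norm_pow, norm_exp]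
      have h1 : (-I * (k * s) * z).re = k * (s * z.im) := by simp; ring
      have h2 : s * z.im = |s| * (σ * z.im) := by
        rw [← hσs]; linear_combination (-s * z.im) * hσσ
      have h3 : Real.exp (-I * (k * s) * z).re ≤ 1 := by
        rw [Real.exp_le_one_iff, h1, h2]
        exact mul_nonpos_of_nonneg_of_nonpos hk.le
          (mul_nonpos_of_nonneg_of_nonpos (abs_nonneg s) hz')
      calc _ ≤ 1 * (C * (1 + ‖z‖) ^ (-ρ)) * ‖z‖ ^ n := by
            gcongr
            exact hQb z hz
        _ = _ := by ring)
    (integrableOn_Ioi_inv_mul_pow_mul_one_add_rpow E hρ)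
    (tendsto_pow_mul_one_add_rpow_atTop hρ) (tendsto_pow_mul_one_add_rpow_nhdsGT_zero hn0 C ρ)
  have hpow : ∀ r : ℝ, 0 < r → ((r ^ (n - 1) : ℝ) : ℂ) = (r : ℂ)⁻¹ * (r : ℂ) ^ n := by
    intro r hr
    obtain ⟨m, hm⟩ := Nat.exists_eq_succ_of_ne_zero hn0
    have : (r : ℂ) ≠ 0 := ofReal_ne_zero.2 hr.ne'
    rw [hm, Nat.succ_sub_one, pow_succ]
    push_cast
    field_simp
  have hnorm : ∀ r : ℝ, 0 < r → ‖r • (ω : E)‖ = r := fun r hr => by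
    simp [norm_smul, abs_of_pos hr]
  refine Eq.trans (setIntegral_congr_fun measurableSet_Ioi fun r hr => ?_)
    (key.trans (setIntegral_congr_fun measurableSet_Ioi fun r hr => ?_))
  · have hr' : 0 < r := hr
    simp only [real_smul, ← hn, hpow r hr', hnorm r hr', real_inner_smul_left, real_inner_smul_right,
      ← hs, ofReal_mul, ofReal_inv]
    ring_nf
  · have hr' : 0 < r := hr
    simp only [real_smul, ← hn, hpow r hr', hσx r hr', real_inner_smul_left, ← hs, abs_mul,
      abs_of_pos hr', ← hσs, ofReal_mul, ofReal_inv, mul_pow]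
    have : -I * (k * s) * (-σ * I * r) = -k * (r * (σ * s)) := by
      linear_combination (k * s * σ * r : ℂ) * I_mul_I
    rw [this]
    ring

/-- The Fourier transform of a radial function whose profile extends holomorphically to the right
half-plane with decay is determined along a ray by its values on any interval of that ray. -/
theorem integral_cexp_mul_radial_eq_zero_of_eventually_eq_zero {Q : ℂ → ℂ} {C ρ : ℝ}
    (hρ : (Module.finrank ℝ E : ℝ) < ρ) (hQd : DifferentiableOn ℂ Q {z | 0 < z.re})
    (hQc : ContinuousOn Q {z | 0 ≤ z.re})
    (hQb : ∀ z : ℂ, 0 ≤ z.re → ‖Q z‖ ≤ C * (1 + ‖z‖) ^ (-ρ)) (e : E) {k₀ : ℝ} (hk₀ : 0 < k₀)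
    (hzero : ∀ᶠ k in 𝓝 k₀, ∫ x : E, cexp (-I * ((inner ℝ x (k • e) : ℝ) : ℂ)) * Q ‖x‖ = 0)
    {k : ℝ} (hk : 0 < k) :
    ∫ x : E, cexp (-I * ((inner ℝ x (k • e) : ℝ) : ℂ)) * Q ‖x‖ = 0 := by
  have hopen : IsOpen {z : ℂ | 0 < z.re} := isOpen_lt continuous_const continuous_re
  have hpre : IsPreconnected {z : ℂ | 0 < z.re} := (convex_halfSpace_re_gt 0).isPreconnected
  have han := (differentiableOn_integral_cexp_neg_mul (μ := (volume : Measure E))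
    (a := fun x : E => |inner ℝ x e|) (by fun_prop) (fun x => abs_nonneg _)
    (integrable_rotatedProfile hρ hQc hQb e)).analyticOnNhd hopen
  have hfreq : ∃ᶠ z in 𝓝[≠] (k₀ : ℂ),
      ∫ x : E, cexp (-z * (|inner ℝ x e| : ℝ)) * rotatedProfile Q e x = 0 := by
    -- Real points near `k₀` accumulate there, which is all the identity theorem requires.
    have ht : Tendsto (fun k : ℝ => (k : ℂ)) (𝓝[≠] k₀) (𝓝[≠] (k₀ : ℂ)) :=
      (continuous_ofReal.tendsto k₀).inf (tendsto_principal_principal.2 fun x hx => by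
        simpa using hx)
    refine ht.frequently (Eventually.frequently ?_)
    filter_upwards [nhdsWithin_le_nhds hzero, nhdsWithin_le_nhds (lt_mem_nhds hk₀)] with k h1 h2
    rw [← h1, integral_cexp_mul_radial_eq_integral_rotatedProfile hρ hQd hQc hQb e h2]
  have h := han.eqOn_zero_of_preconnected_of_frequently_eq_zero hpre
    (by simpa using hk₀ : (k₀ : ℂ) ∈ {z : ℂ | 0 < z.re}) hfreq
    (by simpa using hk : (k : ℂ) ∈ {z : ℂ | 0 < z.re})
  rw [integral_cexp_mul_radial_eq_integral_rotatedProfile hρ hQd hQc hQb e hk]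
  exact h

theorem radial_eq_zero_of_fourier_eq_zero_on_ball {Q : ℂ → ℂ} {C ρ : ℝ}
    (hρ : (Module.finrank ℝ E : ℝ) < ρ) (hQd : DifferentiableOn ℂ Q {z | 0 < z.re})
    (hQc : ContinuousOn Q {z | 0 ≤ z.re})
    (hQb : ∀ z : ℂ, 0 ≤ z.re → ‖Q z‖ ≤ C * (1 + ‖z‖) ^ (-ρ)) {c : E} {R : ℝ} (hR : 0 < R)
    (hzero : ∀ ξ ∈ Metric.ball c R,
      ∫ x : E, cexp (-I * ((inner ℝ x ξ : ℝ) : ℂ)) * Q ‖x‖ = 0) (x : E) :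
    Q ‖x‖ = 0 := by
  obtain ⟨e, k₀, he, hk₀, hmem⟩ : ∃ (e : E) (k₀ : ℝ), ‖e‖ = 1 ∧ 0 < k₀ ∧
      k₀ • e ∈ Metric.ball c R := by
    -- The ray must meet the ball at positive `k₀`, so a centre at the origin is replaced by a point
    -- at distance `R / 2`.
    rcases eq_or_ne c 0 with rfl | hc
    · obtain ⟨e, he⟩ := exists_norm_eq E zero_le_one
      refine ⟨e, R / 2, he, by positivity, ?_⟩
      rw [mem_ball_zero_iff, norm_smul, he, Real.norm_of_nonneg (by positivity)]
      linarith
    · have hc' : ‖c‖ ≠ 0 := norm_ne_zero_iff.2 hc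
      refine ⟨‖c‖⁻¹ • c, ‖c‖, by simp [norm_smul, hc'], norm_pos_iff.2 hc, ?_⟩
      rw [smul_smul, mul_inv_cancel₀ hc', one_smul]
      exact Metric.mem_ball_self hR
  have hray : ∀ k : ℝ, 0 < k →
      ∫ x : E, cexp (-I * ((inner ℝ x (k • e) : ℝ) : ℂ)) * Q ‖x‖ = 0 := fun k hk => by
    refine integral_cexp_mul_radial_eq_zero_of_eventually_eq_zero hρ hQd hQc hQb e hk₀ ?_ hk
    have hcont : ContinuousAt (fun k : ℝ => k • e) k₀ := by fun_prop
    filter_upwards [hcont.preimage_mem_nhds (Metric.isOpen_ball.mem_nhds hmem)] with k hk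
    exact hzero _ hk
  have hF : ∀ ξ : E, ξ ≠ 0 → FourierTransform.fourier (fun x : E => Q ‖x‖) ξ = 0 := by
    intro ξ hξ
    have hpi := Real.pi_pos
    have h1 := hray (2 * Real.pi * ‖ξ‖) (by have := norm_pos_iff.2 hξ; positivity)
    rw [integral_cexp_inner_eq_fourier fun x : E => Q ‖x‖, smul_smul,
      inv_mul_cancel_left₀ (by positivity)] at h1
    rw [← h1]
    exact fourier_radial_eq_of_norm_eq (fun r => Q r) (by simp [norm_smul, he])
  have hQcont : Continuous fun x : E => Q ‖x‖ :=
    hQc.comp_continuous (by fun_prop) fun x => by simp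
  have hQint : Integrable fun x : E => Q ‖x‖ :=
    integrable_of_norm_le_one_add_norm_rpow hρ hQcont.aestronglyMeasurable fun x => by
      simpa using hQb ‖x‖ (by simp)
  have hFae : FourierTransform.fourier (fun x : E => Q ‖x‖) =ᵐ[volume] 0 := by
    filter_upwards [compl_mem_ae_iff.2 (measure_singleton (0 : E))] with ξ hξ
    exact hF ξ hξ
  -- Continuity of the profile makes inversion hold at every point, not just almost everywhere.
  have hinv := hQint.fourierInv_fourier_eq ((integrable_zero E ℂ volume).congr hFae.symm)
    (hQcont.continuousAt (x := x))
  rw [← hinv, Real.fourierInv_eq']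
  refine integral_eq_zero_of_ae ?_
  filter_upwards [hFae] with ξ hξ
  simp [hξ]

end Radial

/-! ### Application to central potentials -/

theorem fourierHat_eq_of_eq_radial {n : ℕ} (hn : n ≠ 0) {V : EuclideanSpace ℝ (Fin n) → ℂ}
    {Q : ℂ → ℂ} (hV : ∀ x, x ≠ 0 → V x = Q ‖x‖) (ξ : EuclideanSpace ℝ (Fin n)) :
    fourierHat V ξ = (((2 * Real.pi) ^ (-(n : ℝ) / 2) : ℝ) : ℂ) *
      ∫ x : EuclideanSpace ℝ (Fin n), cexp (-I * ((inner ℝ x ξ : ℝ) : ℂ)) * Q ‖x‖ := by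
  have : Nonempty (Fin n) := ⟨⟨0, Nat.pos_of_ne_zero hn⟩⟩
  unfold fourierHat
  congr 1
  refine integral_congr_ae ?_
  filter_upwards [compl_mem_ae_iff.2 (measure_singleton (0 : EuclideanSpace ℝ (Fin n)))] with x hx
  rw [hV x hx]

theorem IsCentralInClassA.exists_extension {n : ℕ} {ρ : ℝ} {V : EuclideanSpace ℝ (Fin n) → ℂ}
    (hV : IsCentralInClassA ρ V) : ∃ (Q : ℂ → ℂ) (C : ℝ),
      DifferentiableOn ℂ Q {z | 0 < z.re} ∧ ContinuousOn Q {z | 0 ≤ z.re} ∧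
      (∀ z : ℂ, 0 ≤ z.re → ‖Q z‖ ≤ C * (1 + ‖z‖) ^ (-ρ)) ∧ ∀ x, x ≠ 0 → V x = Q ‖x‖ := by
  obtain ⟨q, ⟨-, Q, hd, hc, hq, C, hC⟩, hVq⟩ := hV
  exact ⟨Q, C, hd, hc, hC, fun x hx => by rw [hVq x hx, hq _ (norm_pos_iff.2 hx)]⟩

theorem mainTheorem11 (n : ℕ) (hn : 2 ≤ n) (ρ₁ ρ₂ : ℝ) (hρ₁ : (n : ℝ) < ρ₁) (hρ₂ : (n : ℝ) < ρ₂)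
    (V₁ V₂ : EuclideanSpace ℝ (Fin n) → ℂ)
    (hV₁ : IsCentralInClassA ρ₁ V₁) (hV₂ : IsCentralInClassA ρ₂ V₂)
    (c : EuclideanSpace ℝ (Fin n)) (R : ℝ) (hR : 0 < R)
    (hball : ∀ ξ ∈ Metric.ball c R, fourierHat V₁ ξ = fourierHat V₂ ξ) :
    ∀ x, x ≠ 0 → V₁ x = V₂ x := by
  intro x hx
  have hn0 : n ≠ 0 := by omega
  have : Nonempty (Fin n) := ⟨⟨0, Nat.pos_of_ne_zero hn0⟩⟩
  obtain ⟨Q₁, C₁, hd₁, hc₁, hb₁, hQ₁⟩ := hV₁.exists_extension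
  obtain ⟨Q₂, C₂, hd₂, hc₂, hb₂, hQ₂⟩ := hV₂.exists_extension
  have hfin : (Module.finrank ℝ (EuclideanSpace ℝ (Fin n)) : ℝ) = n := by simp
  have hint : ∀ {Q : ℂ → ℂ} {C ρ : ℝ}, (n : ℝ) < ρ → ContinuousOn Q {z | 0 ≤ z.re} →
      (∀ z : ℂ, 0 ≤ z.re → ‖Q z‖ ≤ C * (1 + ‖z‖) ^ (-ρ)) → ∀ ξ : EuclideanSpace ℝ (Fin n),
      Integrable fun x => cexp (-I * ((inner ℝ x ξ : ℝ) : ℂ)) * Q ‖x‖ := by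
    intro Q C ρ hρ hc hb ξ
    have hQcont : Continuous fun x : EuclideanSpace ℝ (Fin n) => Q ‖x‖ :=
      hc.comp_continuous (by fun_prop) fun x => by simp
    refine integrable_of_norm_le_one_add_norm_rpow (C := C) (hfin ▸ hρ)
      ((Continuous.mul (by fun_prop) hQcont).aestronglyMeasurable) fun x => ?_
    simpa [norm_exp] using hb ‖x‖ (by simp)
  -- The difference of the profiles decays with the smaller exponent, which still exceeds `n`.
  have hmono : ∀ {C ρ : ℝ}, min ρ₁ ρ₂ ≤ ρ → ∀ z : ℂ,
      C * (1 + ‖z‖) ^ (-ρ) ≤ |C| * (1 + ‖z‖) ^ (-min ρ₁ ρ₂) := by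
    intro C ρ h z
    have h1 : 1 ≤ 1 + ‖z‖ := by simp
    gcongr
    exact le_abs_self C
  have h := radial_eq_zero_of_fourier_eq_zero_on_ball (Q := fun z => Q₁ z - Q₂ z)
    (C := |C₁| + |C₂|) (ρ := min ρ₁ ρ₂) (c := c) (R := R) (hfin ▸ lt_min hρ₁ hρ₂)
    (hd₁.sub hd₂) (hc₁.sub hc₂)
    (fun z hz => (norm_sub_le _ _).trans (by
      rw [add_mul]
      exact add_le_add ((hb₁ z hz).trans (hmono (min_le_left _ _) z))
        ((hb₂ z hz).trans (hmono (min_le_right _ _) z))))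
    hR (fun ξ hξ => by
      have h1 := hball ξ hξ
      rw [fourierHat_eq_of_eq_radial hn0 hQ₁, fourierHat_eq_of_eq_radial hn0 hQ₂] at h1
      have h2 : (((2 * Real.pi) ^ (-(n : ℝ) / 2) : ℝ) : ℂ) ≠ 0 :=
        ofReal_ne_zero.2 (Real.rpow_pos_of_pos Real.two_pi_pos _).ne'
      simp only [mul_sub]
      rw [integral_sub (hint hρ₁ hc₁ hb₁ ξ) (hint hρ₂ hc₂ hb₂ ξ), mul_left_cancel₀ h2 h1, sub_self])
    x
  rw [hQ₁ x hx, hQ₂ x hx]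
  exact sub_eq_zero.1 h
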